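/- For $\mathbb K\in\{\mathbb R,\mathbb C\}$ call $f,g\in\mathbb K[[x,y]]$ *$\mathbb K$-equivalent* if $\phi(f)=g$ for some $\mathbb K$-algebra automorphism $\phi$ of $\mathbb K[[x,y]]$. For signs $\varepsilon,\delta\in\{+,-\}$ the subtype $X_9^{\varepsilon\delta}$ has the normal forms $$X_9^{\varepsilon\delta}(a)=\varepsilon x^4+a\,x^2y^2+\delta y^4,$$ where the parameter $a$ is subject to $a^2\neq 4$ if $\varepsilon=\delta$ and to $a^2\neq-4$ if $\varepsilon\neq\delta$. For two subtypes $T_1,T_2$ let $P_1(T_1,T_2)\subset\mathbb C^2$ be the set of pairs $(u,v)$ of admissible complex parameter values (for $T_1$ and $T_2$, respectively) such that $T_1(u)$ and $T_2(v)$ are $\mathbb C$-equivalent; let $P_2(T_1,T_2)\subset\mathbb R^2$ (respectively $P_3(T_1,T_2)\subset\mathbb R^2$) be the set of pairs $(u,v)$ of admissible real parameter values such that $T_1(u)$ and $T_2(v)$ are $\mathbb C$-equivalent (respectively $\mathbb R$-equivalent). For $\rho,\sigma\in\{1,i\}$ put $$f_1^{\rho,\sigma}(a)=\rho\sigma a,\qquad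 f_3^{\rho,\sigma}(a)=\frac{2\sigma a+12\rho\sigma}{a-2\rho},\qquad f_5^{\rho,\sigma}(a)=\frac{-2\sigma a+12\rho\sigma}{a+2\rho},$$ $$f_2^{\rho,\sigma}(a)=-\rho\sigma a,\qquad f_4^{\rho,\sigma}(a)=\frac{2\sigma a-12\rho\sigma}{a+2\rho},\qquad f_6^{\rho,\sigma}(a)=\frac{-2\sigma a-12\rho\sigma}{a-2\rho},$$ and let $\Gamma_\Omega(g_1,\dots,g_m)=\{(a,g_k(a)) : a\in\Omega,\ 1\le k\le m\}$ denote the joint graph over $\Omega$. Let $\mathbb C'=\mathbb C\setminus\{-2,2\}$, $\mathbb R'=\mathbb R\setminus\{-2,2\}$, $\mathbb C''=\mathbb C\setminus\{-2i,2i\}$. **Theorem.** 1. If $T_1,T_2\in\{X_9^{++},X_9^{--}\}$, then $P_1(T_1,T_2)=\Gamma_{\mathbb C'}(f_1^{1,1},\dots,f_6^{1,1})$ and $P_2(T_1,T_2)=\Gamma_{\mathbb R'}(f_1^{1,1},\dots,f_6^{1,1})$. Moreover - $P_3(X_9^{++},X_9^{++})=\Gamma_{\mathbb R'}(f_1^{1,1})\cup\Gamma_{\{a\in\mathbb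 R' : a>-2\}}(f_5^{1,1})$, - $P_3(X_9^{--},X_9^{--})=\Gamma_{\mathbb R'}(f_1^{1,1})\cup\Gamma_{\{a\in\mathbb R' : a<2\}}(f_3^{1,1})$, - $P_3(X_9^{++},X_9^{--})=\Gamma_{\{a\in\mathbb R : a<-2\}}(f_4^{1,1})$, - $P_3(X_9^{--},X_9^{++})=\Gamma_{\{a\in\mathbb R : a>2\}}(f_6^{1,1})$. 2. If $T_1,T_2\in\{X_9^{+-},X_9^{-+}\}$, then $P_1(T_1,T_2)=\Gamma_{\mathbb C''}(f_1^{i,i},\dots,f_6^{i,i})$, $P_2(T_1,T_2)=\Gamma_{\mathbb R}(f_1^{1,1},f_2^{1,1})$ and $P_3(T_1,T_2)=\Gamma_{\mathbb R}(f_1^{1,1})$. 3. If $T_1\in\{X_9^{++},X_9^{--}\}$ and $T_2\in\{X_9^{+-},X_9^{-+}\}$, then $P_1(T_1,T_2)=\Gamma_{\mathbb C'}(f_1^{1,i},\dots,f_6^{1,i})$, $P_2(T_1,T_2)=\{(-6,0),(0,0),(6,0)\}$ and $P_3(T_1,T_2)=\varnothing$. 4. If $T_1\in\{X_9^{+-},X_9^{-+}\}$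 and $T_2\in\{X_9^{++},X_9^{--}\}$, then $P_1(T_1,T_2)=\Gamma_{\mathbb C''}(f_1^{i,1},\dots,f_6^{i,1})$, $P_2(T_1,T_2)=\{(0,-6),(0,0),(0,6)\}$ and $P_3(T_1,T_2)=\varnothing$. -/

import Mathlib

namespace X9

/-- All `K`-algebra automorphisms `φ` of `K[[x_s : s ∈ σ]]` with `φ f = g`. -/
def transforms {σ K : Type*} [Field K] (f g : MvPowerSeries σ K) :
    Set (MvPowerSeries σ K ≃ₐ[K] MvPowerSeries σ K) :=
  {φ | φ f = g}

/-- `K`-equivalence (right equivalence) of formal power series. -/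
def KEquiv {σ K : Type*} [Field K] (f g : MvPowerSeries σ K) : Prop :=
  (transforms f g).Nonempty

/-- The four real subtypes `X₉⁺⁺`, `X₉⁻⁻`, `X₉⁺⁻`, `X₉⁻⁺`. -/
inductive RealType
  | pp
  | mm
  | pm
  | mp

/-- The sign of `x⁴` in the normal form. -/
def RealType.sign₁ : RealType → ℤ
  | .pp => 1
  | .mm => -1
  | .pm => 1
  | .mp => -1

/-- The sign of `y⁴` in the normal form. -/
def RealType.sign₂ : RealType → ℤ
  | .pp => 1
  | .mm => -1
  | .pm => -1
  | .mp => 1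

/-- The normal form `± x⁴ + a x² y² ± y⁴ ∈ K[[x, y]]`. -/
noncomputable def NF {K : Type*} [Field K] (T : RealType) (a : K) : MvPowerSeries (Fin 2) K :=
  (T.sign₁ : MvPowerSeries (Fin 2) K) * MvPowerSeries.X 0 ^ 4
    + MvPowerSeries.C a * MvPowerSeries.X 0 ^ 2 * MvPowerSeries.X 1 ^ 2
    + (T.sign₂ : MvPowerSeries (Fin 2) K) * MvPowerSeries.X 1 ^ 4

/-- The restriction on the parameter which belongs to the normal form: `a² ≠ 4` for `X₉⁺⁺` and
`X₉⁻⁻`, and `a² ≠ -4` for `X₉⁺⁻` and `X₉⁻⁺`. -/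
def Admissible {K : Type*} [Field K] : RealType → K → Prop
  | .pp, a => a ^ 2 ≠ 4
  | .mm, a => a ^ 2 ≠ 4
  | .pm, a => a ^ 2 ≠ -4
  | .mp, a => a ^ 2 ≠ -4

/-- Complex parameters, complex transformations. -/
def P₁ (T₁ T₂ : RealType) : Set (ℂ × ℂ) :=
  {p | Admissible T₁ p.1 ∧ Admissible T₂ p.2 ∧ KEquiv (NF T₁ p.1) (NF T₂ p.2)}

/-- Real parameters, complex transformations. -/
def P₂ (T₁ T₂ : RealType) : Set (ℝ × ℝ) :=
  {p | Admissible T₁ p.1 ∧ Admissible T₂ p.2 ∧ KEquiv (NF T₁ (p.1 : ℂ)) (NF T₂ (p.2 : ℂ))}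

/-- Real parameters, real transformations. -/
def P₃ (T₁ T₂ : RealType) : Set (ℝ × ℝ) :=
  {p | Admissible T₁ p.1 ∧ Admissible T₂ p.2 ∧ KEquiv (NF T₁ p.1) (NF T₂ p.2)}

/-- The joint graph over `Ω` of a family of functions; only the values on `Ω` matter. -/
def jointGraph {K ι : Type*} (Ω : Set K) (f : ι → K → K) : Set (K × K) :=
  {p | p.1 ∈ Ω ∧ ∃ i, p.2 = f i p.1}

section functions

variable {K : Type*} [Field K]

def f₁ (ρ σ a : K) : K := ρ * σ * a

def f₂ (ρ σ a : K) : K := -(ρ * σ * a)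

def f₃ (ρ σ a : K) : K := (2 * σ * a + 12 * ρ * σ) / (a - 2 * ρ)

def f₄ (ρ σ a : K) : K := (2 * σ * a - 12 * ρ * σ) / (a + 2 * ρ)

def f₅ (ρ σ a : K) : K := (-2 * σ * a + 12 * ρ * σ) / (a + 2 * ρ)

def f₆ (ρ σ a : K) : K := (-2 * σ * a - 12 * ρ * σ) / (a - 2 * ρ)

/-- The six functions `f₁, …, f₆` with given `ρ`, `σ`. -/
def family (ρ σ : K) : Fin 6 → K → K := ![f₁ ρ σ, f₂ ρ σ, f₃ ρ σ, f₄ ρ σ, f₅ ρ σ, f₆ ρ σ]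

end functions

/-- The complex plane without `2` and `-2`. -/
def C' : Set ℂ := {a | a ≠ -2 ∧ a ≠ 2}

/-- The real line without `2` and `-2`. -/
def R' : Set ℝ := {a | a ≠ -2 ∧ a ≠ 2}

/-- The complex plane without `2i` and `-2i`. -/
def C'' : Set ℂ := {a | a ≠ -2 * Complex.I ∧ a ≠ 2 * Complex.I}

end X9

open X9

open X9

/-! An automorphism of `K[[x, y]]` sends the variables to series without constant term, so the
degree 4 part of the image of a quartic form depends only on the linear parts of these series.
Conversely, every invertible linear substitution is an automorphism. Thus the question is when two
even binary quartics `p x⁴ + q x² y² + r y⁴` are related by a linear substitution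
(`exists_pullsBack`, `kequiv_of_pullsBack`).

Over `ℂ`, put `I = 12pr + q²` and `J = q(36pr - q²)`. These are invariants of weights 4 and 6 in the
determinant, so equivalent quartics have proportional `I³` and `J²`. For `x⁴ + A x² y² + y⁴` this
condition is a polynomial relation `modularRel A B = 0` that splits into six factors, linear in `B`:
the graphs of the six functions. They form the group generated by `A ↦ -A` (from `x ↦ ix`) and `A ↦
(12 - 2A)/(A + 2)` (from `x ± y`), so the relation is also sufficient (`kequiv_pp_iff`). Scaling a
variable by an eighth root of unity turns the other sign patterns into `X₉⁺⁺` with parameter `a` or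
`ia`; this is the origin of `ρ` and `σ`.

For real parameters and complex transformations it remains to find the real zeros of the relation.
If `i` enters, its factors become sums of squares, or pair up into such, and few solutions are left.

For real transformations there are further obstructions: the squared determinant is nonnegative, so
`J` keeps its sign; semidefiniteness of the form is preserved; and the sign of the discriminant `I³
- J²` separates `X₉⁺⁺`, `X₉⁻⁻` from `X₉⁺⁻`, `X₉⁻⁺`. The surviving branches are realised by
substitutions that need only a real fourth root of `±(a + 2)`. -/

open MvPowerSeries in
/-- The quartic `p x⁴ + q x² y² + r y⁴`, evaluated at two power series. -/
noncomputable def evenQuartic {K : Type*} [Field K] (p q r : K) (u v : MvPowerSeries (Fin 2) K) :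
    MvPowerSeries (Fin 2) K :=
  C p * u ^ 4 + C q * u ^ 2 * v ^ 2 + C r * v ^ 4

/-- The substitution `x ↦ α x + β y`, `y ↦ γ x + κ y` carries `p x⁴ + q x² y² + r y⁴` to
`p' x⁴ + q' x² y² + r' y⁴`. -/
structure PullsBack {K : Type*} [Field K] (p q r p' q' r' α β γ κ : K) : Prop where
  c40 : p * α ^ 4 + q * α ^ 2 * γ ^ 2 + r * γ ^ 4 = p'
  c31 : 4 * p * α ^ 3 * β + 2 * q * (α ^ 2 * γ * κ + α * β * γ ^ 2) + 4 * r * γ ^ 3 * κ = 0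
  c22 : 6 * p * α ^ 2 * β ^ 2 + q * (α ^ 2 * κ ^ 2 + 4 * α * β * γ * κ + β ^ 2 * γ ^ 2)
    + 6 * r * γ ^ 2 * κ ^ 2 = q'
  c13 : 4 * p * α * β ^ 3 + 2 * q * (α * β * κ ^ 2 + β ^ 2 * γ * κ) + 4 * r * γ * κ ^ 3 = 0
  c04 : p * β ^ 4 + q * β ^ 2 * κ ^ 2 + r * κ ^ 4 = r'

/-! ### Reduction from power series automorphisms to linear substitutions. -/

section PowerSeries

open MvPowerSeries

variable {K : Type*} [Field K]

theorem NF_eq_evenQuartic (T : RealType) (a : K) :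
    NF T a = evenQuartic (T.sign₁ : K) a (T.sign₂ : K) (X 0) (X 1) := by
  simp [NF, evenQuartic]

theorem X9.KEquiv.refl {σ : Type*} (f : MvPowerSeries σ K) : KEquiv f f :=
  ⟨AlgEquiv.refl, rfl⟩

theorem X9.KEquiv.symm {σ : Type*} {f g : MvPowerSeries σ K} (h : KEquiv f g) : KEquiv g f := by
  obtain ⟨φ, hφ⟩ := h
  exact ⟨φ.symm, φ.symm_apply_eq.2 (Eq.symm hφ)⟩

theorem X9.KEquiv.trans {σ : Type*} {f g h : MvPowerSeries σ K} (h₁ : KEquiv f g)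
    (h₂ : KEquiv g h) : KEquiv f h := by
  obtain ⟨φ, hφ⟩ := h₁
  obtain ⟨ψ, hψ⟩ := h₂
  refine ⟨φ.trans ψ, ?_⟩
  change ψ (φ f) = h
  rw [show φ f = g from hφ]
  exact hψ

theorem X9.KEquiv.neg {σ : Type*} {f g : MvPowerSeries σ K} (h : KEquiv f g) :
    KEquiv (-f) (-g) := by
  obtain ⟨φ, hφ⟩ := h
  exact ⟨φ, by change φ (-f) = -g; rw [map_neg, show φ f = g from hφ]⟩

/-- Automorphisms preserve non-units, and the non-units are the series with zero constant
coefficient. -/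
theorem constantCoeff_algEquiv_X {σ : Type*}
    (φ : MvPowerSeries σ K ≃ₐ[K] MvPowerSeries σ K) (s : σ) :
    constantCoeff (φ (X s)) = 0 := by
  by_contra h
  have hu : IsUnit (φ (X s)) := MvPowerSeries.isUnit_iff_constantCoeff.2 (isUnit_iff_ne_zero.2 h)
  have hX : IsUnit (X s : MvPowerSeries σ K) := by
    simpa using hu.map φ.symm
  have := isUnit_constantCoeff _ hX
  simp at this

theorem homogeneousComponent_C_mul {σ : Type*} (n : ℕ) (a : K) (f : MvPowerSeries σ K) :
    homogeneousComponent n (C a * f) = C a * homogeneousComponent n f := by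
  rw [← smul_eq_C_mul, ← smul_eq_C_mul, map_smul]

/-- Lowest-degree parts multiply. This is why only the linear part of an automorphism acts on a
quartic form. -/
theorem homogeneousComponent_pow_mul_pow {σ : Type*} {u v : MvPowerSeries σ K}
    (hu : 1 ≤ u.order) (hv : 1 ≤ v.order) (m n : ℕ) :
    homogeneousComponent (m + n) (u ^ m * v ^ n) =
      homogeneousComponent 1 u ^ m * homogeneousComponent 1 v ^ n := by
  have key : ∀ {w : MvPowerSeries σ K}, 1 ≤ w.order → ∀ k : ℕ,
      (k : ℕ∞) ≤ (w ^ k).order ∧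
        homogeneousComponent k (w ^ k) = homogeneousComponent 1 w ^ k := by
    intro w hw k
    have ho : ∀ k : ℕ, (k : ℕ∞) ≤ (w ^ k).order := fun k =>
      le_order_pow_of_constantCoeff_eq_zero k (one_le_order_iff_constCoeff_eq_zero.1 hw)
    refine ⟨ho k, ?_⟩
    induction k with
    | zero =>
      ext d
      classical
      rw [coeff_homogeneousComponent]
      simp only [pow_zero, coeff_one, Finsupp.degree_eq_zero_iff]
      split_ifs <;> rfl
    | succ k ih =>
      rw [pow_succ, homogeneousComponent_mul_of_le_order (ho k) (by exact_mod_cast hw), ih,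
        pow_succ]
  rw [homogeneousComponent_mul_of_le_order (key hu m).1 (key hv n).1, (key hu m).2, (key hv n).2]

theorem homogeneousComponent_evenQuartic {u v : MvPowerSeries (Fin 2) K}
    (hu : 1 ≤ u.order) (hv : 1 ≤ v.order) (p q r : K) :
    homogeneousComponent 4 (evenQuartic p q r u v) =
      evenQuartic p q r (homogeneousComponent 1 u) (homogeneousComponent 1 v) := by
  have h1 := homogeneousComponent_pow_mul_pow hu hv 4 0
  have h2 := homogeneousComponent_pow_mul_pow hu hv 2 2
  have h3 := homogeneousComponent_pow_mul_pow hu hv 0 4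
  norm_num at h1 h2 h3
  simp only [evenQuartic, map_add, mul_assoc, homogeneousComponent_C_mul, h1, h2, h3]

theorem exists_eq_single_of_degree_eq_one {d : Fin 2 →₀ ℕ} (hd : d.degree = 1) :
    ∃ i, d = Finsupp.single i 1 := by
  rw [Finsupp.degree_eq_sum, Fin.sum_univ_two] at hd
  obtain h | h : (d 0 = 1 ∧ d 1 = 0) ∨ (d 0 = 0 ∧ d 1 = 1) := by omega
  · refine ⟨0, ?_⟩
    ext i
    fin_cases i <;> simp [h.1, h.2]
  · refine ⟨1, ?_⟩
    ext i
    fin_cases i <;> simp [h.1, h.2]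

theorem homogeneousComponent_one_eq (u : MvPowerSeries (Fin 2) K) :
    homogeneousComponent 1 u =
      C (coeff (Finsupp.single 0 1) u) * X 0 + C (coeff (Finsupp.single 1 1) u) * X 1 := by
  classical
  ext d
  rw [coeff_homogeneousComponent, map_add, coeff_C_mul, coeff_C_mul, coeff_X, coeff_X]
  by_cases hd : d.degree = 1
  · obtain ⟨i, rfl⟩ := exists_eq_single_of_degree_eq_one hd
    fin_cases i <;> simp [Finsupp.single_left_inj]
  · rw [if_neg hd, if_neg (by rintro rfl; simp at hd), if_neg (by rintro rfl; simp at hd)]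
    simp

theorem homogeneousComponent_one_X (s : Fin 2) :
    homogeneousComponent 1 (X s : MvPowerSeries (Fin 2) K) = X s := by
  rw [homogeneousComponent_one_eq]
  fin_cases s <;> simp [coeff_index_single_X]

theorem coeff_C_mul_X_pow_mul_X_pow (c : K) (i j m n : ℕ) :
    coeff (Finsupp.single 0 m + Finsupp.single 1 n)
      (C c * ((X 0 : MvPowerSeries (Fin 2) K) ^ i * X 1 ^ j)) =
      if m = i ∧ n = j then c else 0 := by
  classical
  rw [coeff_C_mul, X_pow_eq, X_pow_eq, monomial_mul_monomial, coeff_monomial]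
  have : (Finsupp.single (0 : Fin 2) m + Finsupp.single 1 n =
      Finsupp.single 0 i + Finsupp.single 1 j) ↔ m = i ∧ n = j := by
    constructor
    · intro h
      have h0 := DFunLike.congr_fun h 0
      have h1 := DFunLike.congr_fun h 1
      simp at h0 h1
      exact ⟨h0, h1⟩
    · rintro ⟨rfl, rfl⟩; rfl
  simp [this]

theorem evenQuartic_linear (p q r α β γ κ : K) :
    evenQuartic p q r (C α * X 0 + C β * X 1) (C γ * X 0 + C κ * X 1) =
      C (p * α ^ 4 + q * α ^ 2 * γ ^ 2 + r * γ ^ 4) * (X 0 ^ 4 * X 1 ^ 0)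
      + C (4 * p * α ^ 3 * β + 2 * q * (α ^ 2 * γ * κ + α * β * γ ^ 2) + 4 * r * γ ^ 3 * κ)
        * (X 0 ^ 3 * X 1 ^ 1)
      + C (6 * p * α ^ 2 * β ^ 2 + q * (α ^ 2 * κ ^ 2 + 4 * α * β * γ * κ + β ^ 2 * γ ^ 2)
        + 6 * r * γ ^ 2 * κ ^ 2) * (X 0 ^ 2 * X 1 ^ 2)
      + C (4 * p * α * β ^ 3 + 2 * q * (α * β * κ ^ 2 + β ^ 2 * γ * κ) + 4 * r * γ * κ ^ 3)
        * (X 0 ^ 1 * X 1 ^ 3)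
      + C (p * β ^ 4 + q * β ^ 2 * κ ^ 2 + r * κ ^ 4) * (X 0 ^ 0 * X 1 ^ 4) := by
  simp only [evenQuartic, map_add, map_mul, map_pow, map_ofNat]
  ring

/-- Equivalent even quartics are related by a linear substitution. -/
theorem exists_pullsBack {T T' : RealType} {a b : K} (h : KEquiv (NF T a) (NF T' b)) :
    ∃ α β γ κ : K,
      PullsBack (T.sign₁ : K) a T.sign₂ T'.sign₁ b T'.sign₂ α β γ κ := by
  obtain ⟨φ, hφ⟩ := h
  replace hφ : φ (NF T a) = NF T' b := hφ
  rw [NF_eq_evenQuartic, NF_eq_evenQuartic] at hφ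
  have hC : ∀ c : K, φ (C c) = C c := fun c => φ.commutes c
  have hφ' : evenQuartic (T.sign₁ : K) a T.sign₂ (φ (X 0)) (φ (X 1)) =
      evenQuartic (T'.sign₁ : K) b T'.sign₂ (X 0) (X 1) := by
    rw [← hφ]
    simp only [evenQuartic, map_add, map_mul, map_pow, hC]
  have ho : ∀ s, 1 ≤ (φ (X s)).order := fun s =>
    one_le_order_iff_constCoeff_eq_zero.2 (constantCoeff_algEquiv_X φ s)
  have hX : ∀ s : Fin 2, 1 ≤ (X s : MvPowerSeries (Fin 2) K).order := fun s =>
    one_le_order_iff_constCoeff_eq_zero.2 (by simp)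
  have h4 := congrArg (homogeneousComponent 4) hφ'
  rw [homogeneousComponent_evenQuartic (ho 0) (ho 1),
    homogeneousComponent_evenQuartic (hX 0) (hX 1), homogeneousComponent_one_X,
    homogeneousComponent_one_X, homogeneousComponent_one_eq, homogeneousComponent_one_eq,
    evenQuartic_linear] at h4
  have hR : evenQuartic (T'.sign₁ : K) b T'.sign₂ (X 0) (X 1) =
      C (T'.sign₁ : K) * (X 0 ^ 4 * X 1 ^ 0) + C b * (X 0 ^ 2 * X 1 ^ 2)
        + C (T'.sign₂ : K) * (X 0 ^ 0 * X 1 ^ 4) := by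
    simp only [evenQuartic]; ring
  rw [hR] at h4
  have hc := fun m n : ℕ =>
    congrArg (coeff (Finsupp.single (0 : Fin 2) m + Finsupp.single 1 n)) h4
  simp only [map_add (coeff _), coeff_C_mul_X_pow_mul_X_pow] at hc
  refine ⟨coeff (Finsupp.single 0 1) (φ (X 0)), coeff (Finsupp.single 1 1) (φ (X 0)),
    coeff (Finsupp.single 0 1) (φ (X 1)), coeff (Finsupp.single 1 1) (φ (X 1)),
    ?_, ?_, ?_, ?_, ?_⟩
  · simpa using hc 4 0
  · simpa using hc 3 1
  · simpa using hc 2 2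
  · simpa using hc 1 3
  · simpa using hc 0 4

theorem hasSubst_linear (α β γ κ : K) :
    HasSubst (![C α * X 0 + C β * X 1, C γ * X 0 + C κ * X 1] :
      Fin 2 → MvPowerSeries (Fin 2) K) :=
  hasSubst_of_constantCoeff_zero fun s => by fin_cases s <;> simp

/-- Linear substitutions compose by matrix multiplication; the four hypotheses say that the product
of the two matrices is the identity. -/
theorem substAlgHom_linear_comp {α β γ κ α' β' γ' κ' : K}
    (h1 : α * α' + β * γ' = 1) (h2 : α * β' + β * κ' = 0)
    (h3 : γ * α' + κ * γ' = 0) (h4 : γ * β' + κ * κ' = 1) :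
    (substAlgHom (R := K) (hasSubst_linear α' β' γ' κ')).comp
      (substAlgHom (R := K) (hasSubst_linear α β γ κ)) = AlgHom.id K _ := by
  ext1 f
  have hC : ∀ c : K, substAlgHom (R := K) (hasSubst_linear α' β' γ' κ') (C c) = C c :=
    fun c => (substAlgHom (R := K) (hasSubst_linear α' β' γ' κ')).commutes c
  have e : (fun s => substAlgHom (R := K) (hasSubst_linear α' β' γ' κ')
      ((![C α * X 0 + C β * X 1, C γ * X 0 + C κ * X 1] :
        Fin 2 → MvPowerSeries (Fin 2) K) s)) = X := by
    funext s
    have c1 := congrArg (C : K → MvPowerSeries (Fin 2) K) h1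
    have c2 := congrArg (C : K → MvPowerSeries (Fin 2) K) h2
    have c3 := congrArg (C : K → MvPowerSeries (Fin 2) K) h3
    have c4 := congrArg (C : K → MvPowerSeries (Fin 2) K) h4
    simp only [map_add, map_mul, map_one, map_zero] at c1 c2 c3 c4
    fin_cases s
    · change substAlgHom (R := K) _ (C α * X 0 + C β * X 1) = X 0
      rw [map_add, map_mul, map_mul, hC, hC, substAlgHom_X, substAlgHom_X]
      change C α * (C α' * X 0 + C β' * X 1) + C β * (C γ' * X 0 + C κ' * X 1) = X 0
      linear_combination (X 0 : MvPowerSeries (Fin 2) K) * c1 + X 1 * c2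
    · change substAlgHom (R := K) _ (C γ * X 0 + C κ * X 1) = X 1
      rw [map_add, map_mul, map_mul, hC, hC, substAlgHom_X, substAlgHom_X]
      change C γ * (C α' * X 0 + C β' * X 1) + C κ * (C γ' * X 0 + C κ' * X 1) = X 1
      linear_combination (X 0 : MvPowerSeries (Fin 2) K) * c3 + X 1 * c4
  rw [AlgHom.comp_apply, substAlgHom_apply, substAlgHom_apply,
    subst_comp_subst_apply (hasSubst_linear α β γ κ) (hasSubst_linear α' β' γ' κ')]
  simp only [substAlgHom_apply] at e
  rw [e, subst_self]
  rfl

/-- The automorphism of `K[[x, y]]` given by an invertible linear substitution. -/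
noncomputable def linearAut (α β γ κ : K) (h : α * κ - β * γ ≠ 0) :
    MvPowerSeries (Fin 2) K ≃ₐ[K] MvPowerSeries (Fin 2) K :=
  AlgEquiv.ofAlgHom (substAlgHom (R := K) (hasSubst_linear α β γ κ))
    (substAlgHom (R := K) (hasSubst_linear (κ / (α * κ - β * γ)) (-β / (α * κ - β * γ))
      (-γ / (α * κ - β * γ)) (α / (α * κ - β * γ))))
    (substAlgHom_linear_comp (by rw [div_mul_eq_mul_div, div_mul_eq_mul_div, ← add_div, div_eq_iff h]; ring)
      (by rw [div_mul_eq_mul_div, div_mul_eq_mul_div, ← add_div, div_eq_iff h]; ring)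
      (by rw [div_mul_eq_mul_div, div_mul_eq_mul_div, ← add_div, div_eq_iff h]; ring)
      (by rw [div_mul_eq_mul_div, div_mul_eq_mul_div, ← add_div, div_eq_iff h]; ring))
    (substAlgHom_linear_comp (by rw [← mul_div_assoc, ← mul_div_assoc, ← add_div, div_eq_iff h]; ring)
      (by rw [← mul_div_assoc, ← mul_div_assoc, ← add_div, div_eq_iff h]; ring)
      (by rw [← mul_div_assoc, ← mul_div_assoc, ← add_div, div_eq_iff h]; ring)
      (by rw [← mul_div_assoc, ← mul_div_assoc, ← add_div, div_eq_iff h]; ring))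

theorem kequiv_of_pullsBack {T T' : RealType} {a b α β γ κ : K}
    (h : PullsBack (T.sign₁ : K) a T.sign₂ T'.sign₁ b T'.sign₂ α β γ κ)
    (hd : α * κ - β * γ ≠ 0) : KEquiv (NF T a) (NF T' b) := by
  refine ⟨linearAut α β γ κ hd, ?_⟩
  change substAlgHom (R := K) (hasSubst_linear α β γ κ) (NF T a) = NF T' b
  have hC : ∀ c : K, substAlgHom (R := K) (hasSubst_linear α β γ κ) (C c) = C c :=
    fun c => (substAlgHom (R := K) (hasSubst_linear α β γ κ)).commutes c
  have : substAlgHom (R := K) (hasSubst_linear α β γ κ) (NF T a) =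
      evenQuartic (T.sign₁ : K) a T.sign₂ (C α * X 0 + C β * X 1) (C γ * X 0 + C κ * X 1) := by
    rw [NF_eq_evenQuartic]
    simp [evenQuartic, map_add, map_mul, map_pow, hC, substAlgHom_X, -map_intCast,
      -substAlgHom_apply]
  rw [this, evenQuartic_linear, h.c40, h.c31, h.c22, h.c13, h.c04, NF_eq_evenQuartic, map_zero]
  simp only [evenQuartic]
  ring

end PowerSeries

/-! ### Invariants of binary quartics and the relation between parameters. -/

section Invariants

variable {K : Type*} [Field K]

/-- The invariants of degree `2` and `3` of binary quartics, for even quartics. -/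
theorem PullsBack.invariants [CharZero K] {p q r p' q' r' α β γ κ : K}
    (h : PullsBack p q r p' q' r' α β γ κ) :
    12 * p' * r' + q' ^ 2 = (α * κ - β * γ) ^ 4 * (12 * p * r + q ^ 2) ∧
      q' * (36 * p' * r' - q' ^ 2) = (α * κ - β * γ) ^ 6 * (q * (36 * p * r - q ^ 2)) := by
  obtain ⟨h40, h31, h22, h13, h04⟩ := h
  -- The transformation laws are polynomial identities only for the full quartic, including the
  -- coefficients `B`, `D` of `x³y` and `xy³`; these are set to zero afterwards.
  have hI : ∀ P B Q D R : K,
      P = p * α ^ 4 + q * α ^ 2 * γ ^ 2 + r * γ ^ 4 →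
      B = 4 * p * α ^ 3 * β + 2 * q * (α ^ 2 * γ * κ + α * β * γ ^ 2) + 4 * r * γ ^ 3 * κ →
      Q = 6 * p * α ^ 2 * β ^ 2 + q * (α ^ 2 * κ ^ 2 + 4 * α * β * γ * κ + β ^ 2 * γ ^ 2)
        + 6 * r * γ ^ 2 * κ ^ 2 →
      D = 4 * p * α * β ^ 3 + 2 * q * (α * β * κ ^ 2 + β ^ 2 * γ * κ) + 4 * r * γ * κ ^ 3 →
      R = p * β ^ 4 + q * β ^ 2 * κ ^ 2 + r * κ ^ 4 →
      12 * P * R - 3 * B * D + Q ^ 2 = (α * κ - β * γ) ^ 4 * (12 * p * r + q ^ 2) ∧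
      72 * P * Q * R + 9 * B * Q * D - 27 * P * D ^ 2 - 27 * R * B ^ 2 - 2 * Q ^ 3 =
        (α * κ - β * γ) ^ 6 * (72 * p * q * r - 2 * q ^ 3) := by
    rintro P B Q D R rfl rfl rfl rfl rfl
    constructor <;> ring
  obtain ⟨h1, h2⟩ := hI p' 0 q' 0 r' h40.symm h31.symm h22.symm h13.symm h04.symm
  exact ⟨by linear_combination h1, by linear_combination (1 / 2 : K) * h2⟩

theorem PullsBack.eval {p q r p' q' r' α β γ κ : K}
    (h : PullsBack p q r p' q' r' α β γ κ) (x y : K) :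
    p' * x ^ 4 + q' * x ^ 2 * y ^ 2 + r' * y ^ 4 =
      p * (α * x + β * y) ^ 4 + q * (α * x + β * y) ^ 2 * (γ * x + κ * y) ^ 2
        + r * (γ * x + κ * y) ^ 4 := by
  obtain ⟨h40, h31, h22, h13, h04⟩ := h
  rw [← h40, ← h22, ← h04]
  linear_combination -(x ^ 3 * y) * h31 - (x * y ^ 3) * h13

/-- The relation between the parameters of equivalent quartics `x⁴ + A x² y² + y⁴` and
`x⁴ + B x² y² + y⁴`, namely the equality of the `j`-invariants. -/
def modularRel (A B : K) : K :=
  (B ^ 2 - A ^ 2) * ((A - 2) ^ 2 * B ^ 2 - (2 * A + 12) ^ 2) *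
    ((A + 2) ^ 2 * B ^ 2 - (2 * A - 12) ^ 2)

/-- Eliminate `s` by comparing the cube of the first equation with the square of the second; the
resulting polynomial is `108 * modularRel A B`. -/
theorem modularRel_eq_zero_of_invariants [CharZero K] {A B s : K}
    (hI : 12 + B ^ 2 = s ^ 2 * (12 + A ^ 2))
    (hJ : B * (36 - B ^ 2) = s ^ 3 * (A * (36 - A ^ 2))) : modularRel A B = 0 := by
  have h : 108 * modularRel A B = (12 + A ^ 2) ^ 3 * (B * (36 - B ^ 2)) ^ 2 -
      (12 + B ^ 2) ^ 3 * (A * (36 - A ^ 2)) ^ 2 := by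
    simp only [modularRel]; ring
  rw [hI, hJ] at h
  have h0 : 108 * modularRel A B = 0 := by rw [h]; ring
  simpa using h0

/-- At `B² = 4` the relation collapses to `4096 (A² - 4)²`, so admissibility of one parameter gives
that of the other. -/
theorem sq_ne_four_of_modularRel [CharZero K] {A B : K} (hA : A ^ 2 ≠ 4)
    (h : modularRel A B = 0) : B ^ 2 ≠ 4 := by
  intro hB
  have : 4096 * (A ^ 2 - 4) ^ 2 = (0 : K) := by
    simp only [modularRel, hB] at h
    linear_combination h
  have h2 : (A ^ 2 - 4) ^ 2 = 0 := by simpa using this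
  exact hA (sub_eq_zero.1 (pow_eq_zero_iff two_ne_zero |>.1 h2))

theorem exists_eq_family_iff {ρ σ a b : K} (hρ : ρ ^ 2 = 1 ∨ ρ ^ 2 = -1)
    (hσ : σ ^ 4 = 1) (h1 : a ≠ 2 * ρ) (h2 : a ≠ -2 * ρ) :
    (∃ i, b = family ρ σ i a) ↔ modularRel (ρ * a) (σ * b) = 0 := by
  have d1 : a - 2 * ρ ≠ 0 := sub_ne_zero.2 h1
  have d2 : a + 2 * ρ ≠ 0 := fun h => h2 (by linear_combination h)
  have hσ0 : σ ^ 6 ≠ 0 := by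
    refine pow_ne_zero _ ?_
    rintro rfl
    norm_num at hσ
  have hρ0 : ρ ^ 4 ≠ 0 := by
    have : ρ ^ 4 = 1 := by
      rcases hρ with h | h
      · linear_combination (ρ ^ 2 + 1) * h
      · linear_combination (ρ ^ 2 - 1) * h
    rw [this]; exact one_ne_zero
  have e0 : (σ * b) ^ 2 - (ρ * a) ^ 2 =
      σ ^ 2 * ((b - ρ * σ * a) * (b + ρ * σ * a)) := by
    linear_combination (ρ ^ 2 * a ^ 2) * hσ
  have e1 : (ρ * a - 2 * ρ ^ 2) ^ 2 * (σ * b) ^ 2 - (2 * (ρ * a) + 12 * ρ ^ 2) ^ 2 =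
      σ ^ 2 * ρ ^ 2 * ((b * (a - 2 * ρ) - (2 * σ * a + 12 * ρ * σ)) *
        (b * (a - 2 * ρ) - (-2 * σ * a - 12 * ρ * σ))) := by
    linear_combination (ρ ^ 2 * (2 * a + 12 * ρ) ^ 2) * hσ
  have e2 : (ρ * a + 2 * ρ ^ 2) ^ 2 * (σ * b) ^ 2 - (2 * (ρ * a) - 12 * ρ ^ 2) ^ 2 =
      σ ^ 2 * ρ ^ 2 * ((b * (a + 2 * ρ) - (2 * σ * a - 12 * ρ * σ)) *
        (b * (a + 2 * ρ) - (-2 * σ * a + 12 * ρ * σ))) := by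
    linear_combination (ρ ^ 2 * (2 * a - 12 * ρ) ^ 2) * hσ
  -- Inserting `ρ²` in front of the constants changes nothing if `ρ² = 1` and merely swaps the last
  -- two factors if `ρ² = -1`. It makes both factors divisible by `ρ²`.
  have hrel : modularRel (ρ * a) (σ * b) = ((σ * b) ^ 2 - (ρ * a) ^ 2) *
      ((ρ * a - 2 * ρ ^ 2) ^ 2 * (σ * b) ^ 2 - (2 * (ρ * a) + 12 * ρ ^ 2) ^ 2) *
      ((ρ * a + 2 * ρ ^ 2) ^ 2 * (σ * b) ^ 2 - (2 * (ρ * a) - 12 * ρ ^ 2) ^ 2) := by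
    simp only [modularRel]
    rcases hρ with h | h <;> rw [h] <;> ring
  have hfam : (∃ i, b = family ρ σ i a) ↔ (b = f₁ ρ σ a ∨ b = f₂ ρ σ a ∨ b = f₃ ρ σ a ∨
      b = f₄ ρ σ a ∨ b = f₅ ρ σ a ∨ b = f₆ ρ σ a) := by
    simp only [Fin.exists_fin_succ, family]
    simp
  rw [hfam, hrel, e0, e1, e2]
  simp only [f₁, f₂, f₃, f₄, f₅, f₆, eq_div_iff d1, eq_div_iff d2]
  have hσ2 : σ ^ 2 ≠ 0 := by
    rintro h; apply hσ0; rw [show σ ^ 6 = σ ^ 2 * σ ^ 4 by ring, h, zero_mul]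
  have hρ2 : ρ ^ 2 ≠ 0 := by
    rintro h; apply hρ0; rw [show ρ ^ 4 = ρ ^ 2 * ρ ^ 2 by ring, h, zero_mul]
  simp only [mul_eq_zero, hσ2, hρ2, false_or, sub_eq_zero, add_eq_zero_iff_eq_neg]
  have hor : ∀ p₁ p₂ p₃ p₄ p₅ p₆ : Prop, (p₁ ∨ p₂ ∨ p₃ ∨ p₄ ∨ p₅ ∨ p₆) ↔
      (((p₁ ∨ p₂) ∨ p₃ ∨ p₆) ∨ p₄ ∨ p₅) := by grind
  exact hor _ _ _ _ _ _

end Invariants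

/-! ### Explicit linear substitutions. -/

section Equivalences

variable {K : Type*} [Field K]

theorem kequiv_of_diagonal {T T' : RealType} {a b α κ : K} (h0 : α * κ ≠ 0)
    (h1 : (T.sign₁ : K) * α ^ 4 = T'.sign₁) (h2 : a * (α * κ) ^ 2 = b)
    (h3 : (T.sign₂ : K) * κ ^ 4 = T'.sign₂) : KEquiv (NF T a) (NF T' b) := by
  refine kequiv_of_pullsBack (α := α) (β := 0) (γ := 0) (κ := κ)
    ⟨?_, ?_, ?_, ?_, ?_⟩ (by simpa using h0)
  · linear_combination h1
  · ring
  · linear_combination h2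
  · ring
  · linear_combination h3

theorem kequiv_of_swap {T T' : RealType} (a : K) (h1 : T.sign₁ = T'.sign₂)
    (h2 : T.sign₂ = T'.sign₁) : KEquiv (NF T a) (NF T' a) := by
  refine kequiv_of_pullsBack (α := 0) (β := 1) (γ := 1) (κ := 0)
    ⟨?_, ?_, ?_, ?_, ?_⟩ (by simp) <;> simp [h1, h2]

/-- The substitution `x ↦ c (x + y)`, `y ↦ c (x - y)`. -/
theorem kequiv_of_sum_difference [CharZero K] {T T' : RealType} {a b c : K} (hc : c ≠ 0)
    (h1 : ((T.sign₁ : K) + T.sign₂ + a) * c ^ 4 = T'.sign₁) (h2 : T'.sign₂ = T'.sign₁)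
    (h3 : T.sign₁ = T.sign₂)
    (hb : (6 * (T.sign₁ + T.sign₂ : K) - 2 * a) * c ^ 4 = b) :
    KEquiv (NF T a) (NF T' b) := by
  refine kequiv_of_pullsBack (α := c) (β := c) (γ := c) (κ := -c)
    ⟨?_, ?_, ?_, ?_, ?_⟩ ?_
  · linear_combination h1
  · rw [h3]; ring
  · linear_combination hb
  · rw [h3]; ring
  · rw [h2]; linear_combination h1
  · rw [show c * -c - c * c = -2 * c ^ 2 by ring]
    exact mul_ne_zero (by norm_num) (pow_ne_zero _ hc)

end Equivalences

/-! ### Complex equivalence and the sets `P₁`. -/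

section Complex

open Complex

theorem modularRel_of_kequiv_pp {K : Type*} [Field K] [CharZero K] {A B : K}
    (h : KEquiv (NF .pp A) (NF .pp B)) : modularRel A B = 0 := by
  obtain ⟨α, β, γ, κ, h⟩ := exists_pullsBack h
  obtain ⟨hI, hJ⟩ := h.invariants
  simp only [RealType.sign₁, RealType.sign₂] at hI hJ
  push_cast at hI hJ
  exact modularRel_eq_zero_of_invariants (s := (α * κ - β * γ) ^ 2)
    (by linear_combination hI) (by linear_combination hJ)

theorem kequiv_pp_neg (A : ℂ) : KEquiv (NF .pp A) (NF .pp (-A)) := by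
  refine kequiv_of_diagonal (α := I) (κ := 1) (by simp) ?_ ?_ ?_ <;>
    simp [RealType.sign₁, RealType.sign₂]

theorem kequiv_pp_moebius {A B : ℂ} (hA : A ≠ -2) (h : B * (A + 2) = 12 - 2 * A) :
    KEquiv (NF .pp A) (NF .pp B) := by
  have h2 : A + 2 ≠ 0 := fun h => hA (by linear_combination h)
  obtain ⟨c, hc⟩ := IsAlgClosed.exists_pow_nat_eq (A + 2)⁻¹ (n := 4) (by norm_num)
  have hc' : (A + 2) * c ^ 4 = 1 := by rw [hc, mul_inv_cancel₀ h2]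
  refine kequiv_of_sum_difference (c := c) ?_ ?_ rfl rfl ?_
  · rintro rfl
    simp at hc'
  · simp only [RealType.sign₁, RealType.sign₂]; push_cast; linear_combination hc'
  · simp only [RealType.sign₁, RealType.sign₂]; push_cast
    linear_combination B * hc' - c ^ 4 * h

theorem kequiv_pp_iff {A B : ℂ} (hA : A ^ 2 ≠ 4) :
    KEquiv (NF .pp A) (NF .pp B) ↔ modularRel A B = 0 := by
  refine ⟨modularRel_of_kequiv_pp, fun h => ?_⟩
  have h1 : A ≠ -2 := by rintro rfl; norm_num at hA
  have h2 : -A ≠ -2 := by intro h; apply hA; rw [neg_inj.1 h]; norm_num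
  have hf : modularRel A B = (B - A) * (B + A) * (B * (A - 2) - (2 * A + 12)) *
      (B * (A - 2) + (2 * A + 12)) * (B * (A + 2) - (2 * A - 12)) *
      (B * (A + 2) + (2 * A - 12)) := by simp only [modularRel]; ring
  rw [hf] at h
  simp only [mul_eq_zero] at h
  rcases h with ((((h | h) | h) | h) | h) | h
  · rw [sub_eq_zero.1 h]; exact .refl _
  · rw [eq_neg_of_add_eq_zero_left h]; exact kequiv_pp_neg A
  -- The remaining branches are obtained from the Möbius map by changing the sign of its argument,
  -- of its value, or of both.
  · have := (kequiv_pp_neg A).trans (kequiv_pp_moebius h2 (B := -B) (by linear_combination h))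
    simpa using this.trans (kequiv_pp_neg _)
  · exact (kequiv_pp_neg A).trans (kequiv_pp_moebius h2 (B := B) (by linear_combination -h))
  · have := kequiv_pp_moebius h1 (B := -B) (by linear_combination -h)
    simpa using this.trans (kequiv_pp_neg _)
  · exact kequiv_pp_moebius h1 (B := B) (by linear_combination h)

/-- The factor `ρ` such that `T(a)` is complex equivalent to `X₉⁺⁺(ρ a)`. -/
noncomputable def twist : RealType → ℂ
  | .pp => 1
  | .mm => 1
  | .pm => I
  | .mp => I

theorem kequiv_pp_twist (T : RealType) (a : ℂ) : KEquiv (NF T a) (NF .pp (twist T * a)) := by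
  obtain ⟨z, hz⟩ := IsAlgClosed.exists_pow_nat_eq I (n := 2) (by norm_num)
  have hz0 : z ≠ 0 := by rintro rfl; simp [I_ne_zero.symm] at hz
  have hz4 : z ^ 4 = -1 := by rw [show z ^ 4 = (z ^ 2) ^ 2 by ring, hz, I_sq]
  cases T
  · simpa [twist] using X9.KEquiv.refl (NF .pp a)
  · refine kequiv_of_diagonal (α := z) (κ := z⁻¹) (by simp [hz0]) ?_ ?_ ?_ <;>
      simp [RealType.sign₁, RealType.sign₂, twist, hz4, hz0]
  · refine kequiv_of_diagonal (α := 1) (κ := z) (by simp [hz0]) ?_ ?_ ?_ <;>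
      simp [RealType.sign₁, RealType.sign₂, twist, hz4, hz, mul_comm]
  · refine kequiv_of_diagonal (α := z) (κ := 1) (by simp [hz0]) ?_ ?_ ?_ <;>
      simp [RealType.sign₁, RealType.sign₂, twist, hz4, hz, mul_comm]

theorem admissible_iff_twist (T : RealType) (a : ℂ) :
    Admissible T a ↔ (twist T * a) ^ 2 ≠ 4 := by
  cases T <;> simp [Admissible, twist, mul_pow, neg_eq_iff_eq_neg]

theorem mem_P₁_iff {T₁ T₂ : RealType} {a b : ℂ} :
    (a, b) ∈ P₁ T₁ T₂ ↔
      (twist T₁ * a) ^ 2 ≠ 4 ∧ modularRel (twist T₁ * a) (twist T₂ * b) = 0 := by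
  change Admissible T₁ a ∧ Admissible T₂ b ∧ KEquiv (NF T₁ a) (NF T₂ b) ↔ _
  rw [admissible_iff_twist, admissible_iff_twist]
  have hk : KEquiv (NF T₁ a) (NF T₂ b) ↔
      KEquiv (NF .pp (twist T₁ * a)) (NF .pp (twist T₂ * b)) :=
    ⟨fun h => (kequiv_pp_twist T₁ a).symm.trans (h.trans (kequiv_pp_twist T₂ b)),
      fun h => (kequiv_pp_twist T₁ a).trans (h.trans (kequiv_pp_twist T₂ b).symm)⟩
  rw [hk]
  constructor
  · rintro ⟨h1, -, h3⟩
    exact ⟨h1, (kequiv_pp_iff h1).1 h3⟩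
  · rintro ⟨h1, h3⟩
    exact ⟨h1, sq_ne_four_of_modularRel h1 h3, (kequiv_pp_iff h1).2 h3⟩

theorem twist_sq (T : RealType) : twist T ^ 2 = 1 ∨ twist T ^ 2 = -1 := by
  cases T <;> simp [twist]

theorem twist_mul_sq_ne_four_iff (T : RealType) (a : ℂ) :
    (twist T * a) ^ 2 ≠ 4 ↔ a ≠ -2 * twist T ∧ a ≠ 2 * twist T := by
  have h0 : twist T ≠ 0 := by cases T <;> simp [twist]
  have h4 : twist T ^ 4 = 1 := by cases T <;> simp [twist]
  have : twist T ^ 2 * ((twist T * a) ^ 2 - 4) = (a + 2 * twist T) * (a - 2 * twist T) := by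
    linear_combination a ^ 2 * h4
  rw [← sub_ne_zero, ← mul_ne_zero_iff_left (pow_ne_zero 2 h0), this, mul_ne_zero_iff,
    sub_ne_zero, neg_mul, ne_eq, add_eq_zero_iff_eq_neg]

theorem P₁_eq_jointGraph (T₁ T₂ : RealType) :
    P₁ T₁ T₂ = jointGraph {a | a ≠ -2 * twist T₁ ∧ a ≠ 2 * twist T₁}
      (family (twist T₁) (twist T₂)) := by
  ext ⟨a, b⟩
  rw [mem_P₁_iff, twist_mul_sq_ne_four_iff]
  have h4 : twist T₂ ^ 4 = 1 := by cases T₂ <;> simp [twist]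
  constructor
  · rintro ⟨h, hr⟩
    exact ⟨h, (exists_eq_family_iff (twist_sq T₁) h4 h.2 h.1).2 hr⟩
  · rintro ⟨h, hr⟩
    exact ⟨h, (exists_eq_family_iff (twist_sq T₁) h4 h.2 h.1).1 hr⟩

end Complex

/-! ### Real parameters with complex equivalence: the sets `P₂`. -/

section Real

theorem mem_P₂_iff {T₁ T₂ : RealType} {a b : ℝ} :
    (a, b) ∈ P₂ T₁ T₂ ↔ (twist T₁ * a) ^ 2 ≠ 4 ∧ modularRel (twist T₁ * a) (twist T₂ * b) = 0 := by
  rw [← mem_P₁_iff]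
  have : ∀ (T : RealType) (c : ℝ), Admissible T c ↔ Admissible T (c : ℂ) := by
    intro T c
    cases T <;> simp only [Admissible] <;> norm_cast
  change Admissible T₁ a ∧ Admissible T₂ b ∧ _ ↔ _
  rw [this T₁, this T₂]
  rfl

theorem sq_ne_four_iff {K : Type*} [Field K] (a : K) : a ^ 2 ≠ 4 ↔ a ≠ -2 ∧ a ≠ 2 := by
  rw [show (4 : K) = 2 ^ 2 by norm_num, ne_eq, sq_eq_sq_iff_eq_or_eq_neg]
  tauto

theorem ofReal_modularRel (a b : ℝ) : ((modularRel a b : ℝ) : ℂ) = modularRel (a : ℂ) b := by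
  simp [modularRel]

theorem P₂_eq_of_twist_eq_one {T₁ T₂ : RealType} (h₁ : twist T₁ = 1) (h₂ : twist T₂ = 1) :
    P₂ T₁ T₂ = jointGraph R' (family 1 1) := by
  ext ⟨a, b⟩
  rw [mem_P₂_iff, h₁, h₂, one_mul, one_mul, ← ofReal_modularRel, Complex.ofReal_eq_zero]
  have h4 : (a : ℂ) ^ 2 ≠ 4 ↔ a ≠ -2 ∧ a ≠ 2 := by rw [← sq_ne_four_iff]; norm_cast
  rw [h4]
  have := fun h : a ≠ -2 ∧ a ≠ 2 => exists_eq_family_iff (ρ := (1 : ℝ)) (σ := 1) (a := a) (b := b)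
    (by simp) (by simp) (by simpa using h.2) (by simpa using h.1)
  simp only [one_mul] at this
  constructor
  · rintro ⟨h, hr⟩
    exact ⟨h, (this h).2 hr⟩
  · rintro ⟨h, hr⟩
    exact ⟨h, (this h).1 hr⟩

theorem I_mul_ofReal_sq_ne_four (a : ℝ) : (Complex.I * a) ^ 2 ≠ 4 := by
  rw [mul_pow, Complex.I_sq]
  intro h
  have h' : -1 * a ^ 2 = 4 := by exact_mod_cast h
  nlinarith [sq_nonneg a]

/-- For real `a`, `b` the last two factors of the relation are complex conjugates, so their product
is a sum of two squares. -/
theorem modularRel_I_mul_I_mul (a b : ℝ) :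
    modularRel (Complex.I * a) (Complex.I * b) = (((a ^ 2 - b ^ 2) *
      ((a ^ 2 * b ^ 2 - 4 * b ^ 2 + 4 * a ^ 2 - 144) ^ 2 + (4 * a * b ^ 2 - 48 * a) ^ 2) : ℝ) : ℂ) := by
  have h4 : Complex.I ^ 4 = 1 := Complex.I_pow_four
  have h2 := Complex.I_sq
  have e0 : (Complex.I * b) ^ 2 - (Complex.I * a) ^ 2 = (a : ℂ) ^ 2 - b ^ 2 := by
    linear_combination ((b : ℂ) ^ 2 - a ^ 2) * h2
  have e1 : (Complex.I * a - 2) ^ 2 * (Complex.I * b) ^ 2 - (2 * (Complex.I * a) + 12) ^ 2 =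
      ((a : ℂ) ^ 2 * b ^ 2 - 4 * b ^ 2 + 4 * a ^ 2 - 144) +
        Complex.I * (4 * a * b ^ 2 - 48 * a) := by
    rw [mul_pow Complex.I (b : ℂ), h2]
    linear_combination (-(a : ℂ) ^ 2 * b ^ 2 - 4 * a ^ 2) * h2
  have e2 : (Complex.I * a + 2) ^ 2 * (Complex.I * b) ^ 2 - (2 * (Complex.I * a) - 12) ^ 2 =
      ((a : ℂ) ^ 2 * b ^ 2 - 4 * b ^ 2 + 4 * a ^ 2 - 144) -
        Complex.I * (4 * a * b ^ 2 - 48 * a) := by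
    rw [mul_pow Complex.I (b : ℂ), h2]
    linear_combination (-(a : ℂ) ^ 2 * b ^ 2 - 4 * a ^ 2) * h2
  rw [modularRel, e0, e1, e2]
  push_cast
  linear_combination -((a : ℂ) ^ 2 - b ^ 2) * (4 * a * b ^ 2 - 48 * a) ^ 2 * h2

/-- The two squares vanish together only for `a² = b² = 12`, so the second factor contributes
nothing new. -/
theorem sq_eq_sq_of_modularRel {a b : ℝ} (h : (a ^ 2 - b ^ 2) *
    ((a ^ 2 * b ^ 2 - 4 * b ^ 2 + 4 * a ^ 2 - 144) ^ 2 + (4 * a * b ^ 2 - 48 * a) ^ 2) = 0) :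
    b ^ 2 = a ^ 2 := by
  rcases mul_eq_zero.1 h with h | h
  · linarith
  · have h1 : a ^ 2 * b ^ 2 - 4 * b ^ 2 + 4 * a ^ 2 - 144 = 0 := by
      nlinarith [sq_nonneg (a ^ 2 * b ^ 2 - 4 * b ^ 2 + 4 * a ^ 2 - 144),
        sq_nonneg (4 * a * b ^ 2 - 48 * a)]
    have h2 : a * (b ^ 2 - 12) = 0 := by
      rw [h1] at h
      have : 4 * a * b ^ 2 - 48 * a = 0 := by simpa using h
      linarith
    rcases mul_eq_zero.1 h2 with rfl | h2
    · nlinarith [sq_nonneg b]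
    · nlinarith

theorem P₂_eq_of_twist_eq_I {T₁ T₂ : RealType} (h₁ : twist T₁ = Complex.I)
    (h₂ : twist T₂ = Complex.I) : P₂ T₁ T₂ = jointGraph Set.univ ![f₁ 1 1, f₂ 1 1] := by
  ext ⟨a, b⟩
  rw [mem_P₂_iff, h₁, h₂, modularRel_I_mul_I_mul, Complex.ofReal_eq_zero]
  have hg : (a, b) ∈ jointGraph Set.univ ![f₁ 1 1, f₂ 1 1] ↔ b = a ∨ b = -a := by
    simp [jointGraph, f₁, f₂]
  rw [hg]
  constructor
  · rintro ⟨-, h⟩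
    exact sq_eq_sq_iff_eq_or_eq_neg.1 (sq_eq_sq_of_modularRel h)
  · rintro (rfl | rfl)
    · exact ⟨I_mul_ofReal_sq_ne_four _, by ring⟩
    · exact ⟨I_mul_ofReal_sq_ne_four _, by ring⟩

theorem modularRel_ofReal_I_mul (a b : ℝ) :
    modularRel (a : ℂ) (Complex.I * b) = ((-((b ^ 2 + a ^ 2) *
      ((a - 2) ^ 2 * b ^ 2 + (2 * a + 12) ^ 2) *
      ((a + 2) ^ 2 * b ^ 2 + (2 * a - 12) ^ 2)) : ℝ) : ℂ) := by
  rw [modularRel, mul_pow, Complex.I_sq]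
  push_cast
  ring

theorem modularRel_I_mul_ofReal (a b : ℝ) :
    modularRel (Complex.I * a) (b : ℂ) = (((b ^ 2 + a ^ 2) *
      ((b - 2) ^ 2 * a ^ 2 + (2 * b + 12) ^ 2) *
      ((b + 2) ^ 2 * a ^ 2 + (2 * b - 12) ^ 2) : ℝ) : ℂ) := by
  have h2 := Complex.I_sq
  have h : modularRel (Complex.I * a) (b : ℂ) = -modularRel (b : ℂ) (Complex.I * a) := by
    simp only [modularRel]; ring
  rw [h, modularRel_ofReal_I_mul]
  push_cast
  ring

theorem mixed_relation_iff {a b : ℝ} : (a ^ 2 ≠ 4 ∧ (b ^ 2 + a ^ 2) *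
      ((a - 2) ^ 2 * b ^ 2 + (2 * a + 12) ^ 2) *
      ((a + 2) ^ 2 * b ^ 2 + (2 * a - 12) ^ 2) = 0) ↔ b = 0 ∧ (a = -6 ∨ a = 0 ∨ a = 6) := by
  constructor
  · rintro ⟨ha, h⟩
    obtain ⟨h1, h2⟩ := (sq_ne_four_iff a).1 ha
    rcases mul_eq_zero.1 h with h | h
    · rcases mul_eq_zero.1 h with h | h
      · obtain ⟨hb, ha⟩ := (add_eq_zero_iff_of_nonneg (sq_nonneg b) (sq_nonneg a)).1 h
        exact ⟨by simpa using hb, .inr (.inl (by simpa using ha))⟩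
      · obtain ⟨hb, ha⟩ := (add_eq_zero_iff_of_nonneg (by positivity) (sq_nonneg _)).1 h
        refine ⟨by simpa [sub_eq_zero, h2] using hb, .inl ?_⟩
        have := pow_eq_zero_iff two_ne_zero |>.1 ha
        linarith
    · obtain ⟨hb, ha⟩ := (add_eq_zero_iff_of_nonneg (by positivity) (sq_nonneg _)).1 h
      have h3 : a + 2 ≠ 0 := fun h => h1 (by linarith)
      refine ⟨by simpa [h3] using hb, .inr (.inr ?_)⟩
      have := pow_eq_zero_iff two_ne_zero |>.1 ha
      linarith
  · rintro ⟨rfl, rfl | rfl | rfl⟩ <;> norm_num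

theorem P₂_eq_of_twist_eq_one_of_twist_eq_I {T₁ T₂ : RealType} (h₁ : twist T₁ = 1)
    (h₂ : twist T₂ = Complex.I) : P₂ T₁ T₂ = {(-6, 0), (0, 0), (6, 0)} := by
  ext ⟨a, b⟩
  rw [mem_P₂_iff, h₁, h₂, one_mul, modularRel_ofReal_I_mul, Complex.ofReal_eq_zero, neg_eq_zero]
  have h4 : (a : ℂ) ^ 2 ≠ 4 ↔ a ^ 2 ≠ 4 := by norm_cast
  rw [h4, mixed_relation_iff]
  simp only [Set.mem_insert_iff, Set.mem_singleton_iff, Prod.mk.injEq]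
  tauto

theorem P₂_eq_of_twist_eq_I_of_twist_eq_one {T₁ T₂ : RealType} (h₁ : twist T₁ = Complex.I)
    (h₂ : twist T₂ = 1) : P₂ T₁ T₂ = {(0, -6), (0, 0), (0, 6)} := by
  ext ⟨a, b⟩
  rw [mem_P₂_iff, h₁, h₂, one_mul]
  -- Admissibility is moved from `a` to `b` so that `mixed_relation_iff` applies with the roles of
  -- the parameters exchanged.
  have hswap : (Complex.I * (a : ℂ)) ^ 2 ≠ 4 ∧ modularRel (Complex.I * a) (b : ℂ) = 0 ↔
      b ^ 2 ≠ 4 ∧ modularRel (Complex.I * a) (b : ℂ) = 0 := by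
    constructor
    · rintro ⟨h, hr⟩
      exact ⟨by exact_mod_cast sq_ne_four_of_modularRel h hr, hr⟩
    · rintro ⟨-, hr⟩
      exact ⟨I_mul_ofReal_sq_ne_four a, hr⟩
  rw [hswap, modularRel_I_mul_ofReal, Complex.ofReal_eq_zero, add_comm (b ^ 2) (a ^ 2),
    mixed_relation_iff]
  simp only [Set.mem_insert_iff, Set.mem_singleton_iff, Prod.mk.injEq]
  tauto

/-! ### Obstructions to real equivalence: sign of the cubic invariant and definiteness. -/

theorem exists_real_invariants {T₁ T₂ : RealType} {a b : ℝ} (h : KEquiv (NF T₁ a) (NF T₂ b)) :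
    ∃ s : ℝ, 0 ≤ s ∧
      12 * (T₂.sign₁ : ℝ) * T₂.sign₂ + b ^ 2 = s ^ 2 * (12 * T₁.sign₁ * T₁.sign₂ + a ^ 2) ∧
      b * (36 * (T₂.sign₁ : ℝ) * T₂.sign₂ - b ^ 2) =
        s ^ 3 * (a * (36 * T₁.sign₁ * T₁.sign₂ - a ^ 2)) := by
  obtain ⟨α, β, γ, κ, h⟩ := exists_pullsBack h
  obtain ⟨hI, hJ⟩ := h.invariants
  exact ⟨(α * κ - β * γ) ^ 2, sq_nonneg _, by rw [hI]; ring, by rw [hJ]; ring⟩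

theorem cubic_invariant_sign {T₁ T₂ : RealType} {a b : ℝ} (h : KEquiv (NF T₁ a) (NF T₂ b)) :
    0 ≤ (a * (36 * (T₁.sign₁ : ℝ) * T₁.sign₂ - a ^ 2)) *
        (b * (36 * (T₂.sign₁ : ℝ) * T₂.sign₂ - b ^ 2)) := by
  obtain ⟨s, hs, -, hJ⟩ := exists_real_invariants h
  rw [hJ]
  have : 0 ≤ s ^ 3 * (a * (36 * (T₁.sign₁ : ℝ) * T₁.sign₂ - a ^ 2)) ^ 2 := by positivity
  linarith

theorem exists_eval_eq {T₁ T₂ : RealType} {a b : ℝ} (h : KEquiv (NF T₁ a) (NF T₂ b)) (x y : ℝ) :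
    ∃ u v : ℝ, (T₂.sign₁ : ℝ) * x ^ 4 + b * x ^ 2 * y ^ 2 + T₂.sign₂ * y ^ 4 =
      T₁.sign₁ * u ^ 4 + a * u ^ 2 * v ^ 2 + T₁.sign₂ * v ^ 4 := by
  obtain ⟨α, β, γ, κ, h⟩ := exists_pullsBack h
  exact ⟨_, _, h.eval x y⟩

/-- For `a ≥ -2` the form is nonnegative, since it equals `(u² - v²)² + (a + 2) u² v²`; the second
form takes the value `b + 2` at `(1, 1)`. -/
theorem neg_two_le_of_kequiv_pp {a b : ℝ} (h : KEquiv (NF .pp a) (NF .pp b)) (ha : -2 ≤ a) :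
    -2 ≤ b := by
  obtain ⟨u, v, h⟩ := exists_eval_eq h 1 1
  simp only [RealType.sign₁, RealType.sign₂] at h
  push_cast at h
  have : 0 ≤ (u ^ 2 - v ^ 2) ^ 2 + (a + 2) * (u ^ 2 * v ^ 2) :=
    add_nonneg (sq_nonneg _) (mul_nonneg (by linarith) (by positivity))
  linarith

theorem lt_neg_two_of_kequiv_pp_mm {a b : ℝ} (h : KEquiv (NF .pp a) (NF .mm b)) : a < -2 := by
  by_contra! ha
  obtain ⟨u, v, h⟩ := exists_eval_eq h 1 0
  simp only [RealType.sign₁, RealType.sign₂] at h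
  push_cast at h
  have : 0 ≤ (u ^ 2 - v ^ 2) ^ 2 + (a + 2) * (u ^ 2 * v ^ 2) :=
    add_nonneg (sq_nonneg _) (mul_nonneg (by linarith) (by positivity))
  linarith

theorem NF_mm_neg {K : Type*} [Field K] (a : K) : NF .mm (-a) = -NF .pp a := by
  simp only [NF, RealType.sign₁, RealType.sign₂, map_neg]
  push_cast
  ring

theorem NF_pp_neg {K : Type*} [Field K] (a : K) : NF .pp (-a) = -NF .mm a := by
  rw [← neg_neg a, NF_mm_neg, neg_neg, neg_neg]

theorem two_lt_of_kequiv_pp_mm {a b : ℝ} (h : KEquiv (NF .pp a) (NF .mm b)) : 2 < b := by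
  have := h.neg.symm
  rw [← NF_mm_neg, ← NF_pp_neg] at this
  linarith [lt_neg_two_of_kequiv_pp_mm this]

theorem modularRel_eq_zero_iff {K : Type*} [Field K] {A B : K} : modularRel A B = 0 ↔
    B = A ∨ B = -A ∨ B * (A - 2) = 2 * A + 12 ∨ B * (A - 2) = -(2 * A + 12) ∨
      B * (A + 2) = 2 * A - 12 ∨ B * (A + 2) = 12 - 2 * A := by
  have hf : modularRel A B = (B - A) * ((B - -A) * ((B * (A - 2) - (2 * A + 12)) *
      ((B * (A - 2) - -(2 * A + 12)) * ((B * (A + 2) - (2 * A - 12)) *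
      (B * (A + 2) - (12 - 2 * A)))))) := by simp only [modularRel]; ring
  rw [hf]
  simp only [mul_eq_zero, sub_eq_zero]

theorem eq_of_mul_sub_sq_eq_zero {a : ℝ} (h : a * (36 - a ^ 2) = 0) :
    a = 0 ∨ a = 6 ∨ a = -6 := by
  have h' : a * ((6 - a) * (6 + a)) = 0 := by rw [← h]; ring
  rcases mul_eq_zero.1 h' with h | h
  · exact .inl h
  · rcases mul_eq_zero.1 h with h | h
    · exact .inr (.inl (by linarith))
    · exact .inr (.inr (by linarith))

/-- Used with `u`, `v` the cubic invariants at `a` and `b`, and `d` the denominator of a branch. If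
the branch reverses the sign of the invariant, only its zeros `a = 0, ±6` survive. -/
theorem eq_zero_of_mul_nonneg_of_mul_pow {u v d k : ℝ} (h : 0 ≤ u * v) (hv : v * d ^ 3 = k * u)
    (hk : k * d < 0) : u = 0 := by
  have h1 : u * v * d ^ 4 = k * d * u ^ 2 := by linear_combination u * d * hv
  have h2 : 0 ≤ u * v * d ^ 4 := by positivity
  by_contra hu
  have h3 : 0 < u ^ 2 := by positivity
  nlinarith

/-- On each excluded range of a branch either definiteness or the sign of the cubic invariant fails,
except at points with `a ∈ {0, 6, -6}` where the branch meets one of the two permitted graphs. -/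
theorem real_pp_pp {a b : ℝ} (ha : a ^ 2 ≠ 4) (h : KEquiv (NF .pp a) (NF .pp b)) :
    b = a ∨ (-2 < a ∧ b * (a + 2) = 12 - 2 * a) := by
  obtain ⟨h1, h2⟩ := (sq_ne_four_iff a).1 ha
  have hr := modularRel_of_kequiv_pp h
  have d1 := neg_two_le_of_kequiv_pp h
  have d2 := neg_two_le_of_kequiv_pp h.symm
  have hJ := cubic_invariant_sign h
  simp only [RealType.sign₁, RealType.sign₂, Int.cast_one, mul_one] at hJ
  rcases modularRel_eq_zero_iff.1 hr with h | h | h | h | h | h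
  · exact .inl h
  · have hz := eq_zero_of_mul_nonneg_of_mul_pow (d := 1) (k := -1) hJ (by rw [h]; ring)
      (by norm_num)
    rcases eq_of_mul_sub_sq_eq_zero hz with rfl | rfl | rfl
    · left; linarith
    · have := d1 (by norm_num); linarith
    · have := d2 (by linarith); linarith
  -- This form of the branch equation shows the sign of `b + 2`, which decides definiteness.
  · have hb : (b + 2) * (a - 2) = 4 * (a + 2) := by linear_combination h
    rcases lt_or_gt_of_ne h2 with h2 | h2
    · rcases lt_or_gt_of_ne h1 with h1 | h1
      · have := d2 (by nlinarith)
        linarith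
      · have := d1 h1.le
        nlinarith
    -- The constant comes from `N (36 (a - 2)² - N²) = -64 a (36 - a²)` for the numerator `N = 2a +
    -- 12`.
    · have hz := eq_zero_of_mul_nonneg_of_mul_pow (d := a - 2) (k := -64) hJ (by
        rw [show b * (36 - b ^ 2) * (a - 2) ^ 3 =
          36 * (b * (a - 2)) * (a - 2) ^ 2 - (b * (a - 2)) ^ 3 by ring, h]; ring) (by linarith)
      rcases eq_of_mul_sub_sq_eq_zero hz with rfl | rfl | rfl
      · linarith
      · left; linarith
      · linarith
  · have hb : (b + 2) * (a - 2) = -16 := by linear_combination h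
    rcases lt_or_gt_of_ne h2 with h2 | h2
    · have ha2 := d2 (by nlinarith)
      have hz := eq_zero_of_mul_nonneg_of_mul_pow (d := a - 2) (k := 64) hJ (by
        rw [show b * (36 - b ^ 2) * (a - 2) ^ 3 =
          36 * (b * (a - 2)) * (a - 2) ^ 2 - (b * (a - 2)) ^ 3 by ring, h]; ring) (by linarith)
      rcases eq_of_mul_sub_sq_eq_zero hz with rfl | rfl | rfl
      · right; constructor <;> linarith
      · linarith
      · linarith
    · have := d1 (by linarith)
      nlinarith
  · have hb : (b + 2) * (a + 2) = 4 * (a - 2) := by linear_combination h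
    rcases lt_or_gt_of_ne h1 with h1 | h1
    · have := d2 (by nlinarith)
      linarith
    · have hb2 := d1 h1.le
      have hz := eq_zero_of_mul_nonneg_of_mul_pow (d := a + 2) (k := -64) hJ (by
        rw [show b * (36 - b ^ 2) * (a + 2) ^ 3 =
          36 * (b * (a + 2)) * (a + 2) ^ 2 - (b * (a + 2)) ^ 3 by ring, h]; ring) (by linarith)
      rcases eq_of_mul_sub_sq_eq_zero hz with rfl | rfl | rfl
      · linarith
      · right; constructor <;> linarith
      · linarith
  · rcases lt_or_gt_of_ne h1 with h1 | h1
    · have hz := eq_zero_of_mul_nonneg_of_mul_pow (d := a + 2) (k := 64) hJ (by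
        rw [show b * (36 - b ^ 2) * (a + 2) ^ 3 =
          36 * (b * (a + 2)) * (a + 2) ^ 2 - (b * (a + 2)) ^ 3 by ring, h]; ring) (by linarith)
      rcases eq_of_mul_sub_sq_eq_zero hz with rfl | rfl | rfl
      · linarith
      · linarith
      · left; linarith
    · exact .inr ⟨h1, h⟩

theorem real_pp_mm {a b : ℝ} (h : KEquiv (NF .pp a) (NF .mm b)) :
    a < -2 ∧ b * (a + 2) = 2 * a - 12 := by
  have d1 := lt_neg_two_of_kequiv_pp_mm h
  have d2 := two_lt_of_kequiv_pp_mm h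
  obtain ⟨s, -, hI, hJ'⟩ := exists_real_invariants h
  have hJ := cubic_invariant_sign h
  simp only [RealType.sign₁, RealType.sign₂, Int.cast_one, Int.cast_neg, mul_one, mul_neg,
    neg_neg] at hI hJ' hJ
  refine ⟨d1, ?_⟩
  rcases modularRel_eq_zero_iff.1 (modularRel_eq_zero_of_invariants hI hJ') with
    h | h | h | h | h | h
  · linarith
  · have hz := eq_zero_of_mul_nonneg_of_mul_pow (d := 1) (k := -1) hJ (by rw [h]; ring)
      (by norm_num)
    rcases eq_of_mul_sub_sq_eq_zero hz with rfl | rfl | rfl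
    · linarith
    · linarith
    -- At `a = -6`, `b = 6` the graph of `b = -a` meets the asserted one.
    · rw [h]; norm_num
  · have : (b - 2) * (a - 2) = 16 := by linear_combination h
    nlinarith
  · have : (b - 2) * (a - 2) = -4 * (a + 2) := by linear_combination h
    nlinarith
  · exact h
  · nlinarith

/-! ### Real substitutions and the sets `P₃`. -/

theorem exists_pow_four_mul_eq_one {x : ℝ} (hx : 0 < x) : ∃ c : ℝ, c ≠ 0 ∧ x * c ^ 4 = 1 := by
  refine ⟨√(√x⁻¹), by positivity, ?_⟩
  rw [show √(√x⁻¹) ^ 4 = (√(√x⁻¹) ^ 2) ^ 2 by ring, Real.sq_sqrt (by positivity),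
    Real.sq_sqrt (by positivity), mul_inv_cancel₀ hx.ne']

theorem real_kequiv_pp_pp {a b : ℝ} (ha : -2 < a) (h : b * (a + 2) = 12 - 2 * a) :
    KEquiv (NF .pp a) (NF .pp b) := by
  obtain ⟨c, hc, hc'⟩ := exists_pow_four_mul_eq_one (x := a + 2) (by linarith)
  refine kequiv_of_sum_difference hc ?_ rfl rfl ?_ <;>
    simp only [RealType.sign₁, RealType.sign₂] <;> push_cast
  · linear_combination hc'
  · linear_combination b * hc' - c ^ 4 * h

theorem real_kequiv_pp_mm {a b : ℝ} (ha : a < -2) (h : b * (a + 2) = 2 * a - 12) :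
    KEquiv (NF .pp a) (NF .mm b) := by
  obtain ⟨c, hc, hc'⟩ := exists_pow_four_mul_eq_one (x := -(a + 2)) (by linarith)
  refine kequiv_of_sum_difference hc ?_ rfl rfl ?_ <;>
    simp only [RealType.sign₁, RealType.sign₂] <;> push_cast
  · linear_combination -hc'
  · linear_combination b * hc' + c ^ 4 * h

theorem mem_P₃_pp_pp_iff {a b : ℝ} : (a, b) ∈ P₃ .pp .pp ↔
    a ^ 2 ≠ 4 ∧ (b = a ∨ (-2 < a ∧ b * (a + 2) = 12 - 2 * a)) := by
  change a ^ 2 ≠ 4 ∧ b ^ 2 ≠ 4 ∧ _ ↔ _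
  constructor
  · rintro ⟨h1, -, h3⟩
    exact ⟨h1, real_pp_pp h1 h3⟩
  · rintro ⟨h1, rfl | ⟨h2, h3⟩⟩
    · exact ⟨h1, h1, .refl _⟩
    · refine ⟨h1, ?_, real_kequiv_pp_pp h2 h3⟩
      rw [sq_ne_four_iff] at h1 ⊢
      constructor
      · rintro rfl; linarith
      · rintro rfl; exact h1.2 (by linarith)

theorem mem_P₃_pp_mm_iff {a b : ℝ} : (a, b) ∈ P₃ .pp .mm ↔
    a < -2 ∧ b * (a + 2) = 2 * a - 12 := by
  change a ^ 2 ≠ 4 ∧ b ^ 2 ≠ 4 ∧ _ ↔ _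
  constructor
  · rintro ⟨-, -, h⟩
    exact real_pp_mm h
  · rintro ⟨h1, h2⟩
    refine ⟨by nlinarith, ?_, real_kequiv_pp_mm h1 h2⟩
    rw [sq_ne_four_iff]
    constructor <;> rintro rfl <;> linarith

/-- Negating both series exchanges `X₉⁺⁺(a)` and `X₉⁻⁻(-a)`, so the cases starting from `X₉⁻⁻`
follow from those starting from `X₉⁺⁺`. -/
theorem neg_mem_P₃_iff {T₁ T₂ S₁ S₂ : RealType} {a b : ℝ}
    (hN₁ : NF S₁ (-a) = -NF T₁ a) (hN₂ : NF S₂ (-b) = -NF T₂ b)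
    (hA₁ : Admissible S₁ (-a) ↔ Admissible T₁ a) (hA₂ : Admissible S₂ (-b) ↔ Admissible T₂ b) :
    (a, b) ∈ P₃ T₁ T₂ ↔ (-a, -b) ∈ P₃ S₁ S₂ := by
  change _ ∧ _ ∧ _ ↔ Admissible S₁ (-a) ∧ Admissible S₂ (-b) ∧ KEquiv (NF S₁ (-a)) (NF S₂ (-b))
  rw [hA₁, hA₂, hN₁, hN₂]
  refine and_congr_right fun _ => and_congr_right fun _ => ⟨fun h => h.neg, fun h => ?_⟩
  simpa using h.neg

theorem mem_P₃_mm_mm_iff {a b : ℝ} : (a, b) ∈ P₃ .mm .mm ↔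
    a ^ 2 ≠ 4 ∧ (b = a ∨ (a < 2 ∧ b * (a - 2) = 2 * a + 12)) := by
  rw [neg_mem_P₃_iff (NF_pp_neg a) (NF_pp_neg b) (by simp [Admissible]) (by simp [Admissible]),
    mem_P₃_pp_pp_iff, neg_sq, neg_inj, neg_lt_neg_iff]
  refine and_congr_right fun _ => or_congr_right (and_congr_right fun _ => ?_)
  constructor <;> intro h <;> linear_combination h

theorem mem_P₃_mm_pp_iff {a b : ℝ} : (a, b) ∈ P₃ .mm .pp ↔
    2 < a ∧ b * (a - 2) = -2 * a - 12 := by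
  rw [neg_mem_P₃_iff (NF_pp_neg a) (NF_mm_neg b) (by simp [Admissible]) (by simp [Admissible]),
    mem_P₃_pp_mm_iff, neg_lt_neg_iff]
  refine and_congr_right fun _ => ?_
  constructor <;> intro h <;> linear_combination h

theorem P₃_pp_pp :
    P₃ .pp .pp = jointGraph R' ![f₁ 1 1] ∪ jointGraph {a | a ∈ R' ∧ -2 < a} ![f₅ 1 1] := by
  ext ⟨a, b⟩
  rw [mem_P₃_pp_pp_iff, sq_ne_four_iff]
  simp only [jointGraph, R', Set.mem_union, Set.mem_ofPred_eq, Fin.exists_fin_one,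
    Matrix.cons_val_fin_one, f₁, f₅, mul_one, one_mul]
  constructor
  · rintro ⟨h, rfl | ⟨h1, h2⟩⟩
    · exact .inl ⟨h, rfl⟩
    · exact .inr ⟨⟨h, h1⟩, (eq_div_iff (by linarith)).2 (by linarith)⟩
  · rintro (⟨h, rfl⟩ | ⟨⟨h, h1⟩, h2⟩)
    · exact ⟨h, .inl rfl⟩
    · exact ⟨h, .inr ⟨h1, by rw [eq_div_iff (by linarith)] at h2; linarith⟩⟩

theorem P₃_mm_mm :
    P₃ .mm .mm = jointGraph R' ![f₁ 1 1] ∪ jointGraph {a | a ∈ R' ∧ a < 2} ![f₃ 1 1] := by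
  ext ⟨a, b⟩
  rw [mem_P₃_mm_mm_iff, sq_ne_four_iff]
  simp only [jointGraph, R', Set.mem_union, Set.mem_ofPred_eq, Fin.exists_fin_one,
    Matrix.cons_val_fin_one, f₁, f₃, mul_one, one_mul]
  constructor
  · rintro ⟨h, rfl | ⟨h1, h2⟩⟩
    · exact .inl ⟨h, rfl⟩
    · exact .inr ⟨⟨h, h1⟩, (eq_div_iff (by linarith)).2 h2⟩
  · rintro (⟨h, rfl⟩ | ⟨⟨h, h1⟩, h2⟩)
    · exact ⟨h, .inl rfl⟩
    · exact ⟨h, .inr ⟨h1, (eq_div_iff (by linarith)).1 h2⟩⟩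

theorem P₃_pp_mm : P₃ .pp .mm = jointGraph {a | a < -2} ![f₄ 1 1] := by
  ext ⟨a, b⟩
  rw [mem_P₃_pp_mm_iff]
  simp only [jointGraph, Set.mem_ofPred_eq, Fin.exists_fin_one, Matrix.cons_val_fin_one, f₄,
    mul_one]
  refine and_congr_right fun h => (eq_div_iff ?_).symm
  linarith

theorem P₃_mm_pp : P₃ .mm .pp = jointGraph {a | 2 < a} ![f₆ 1 1] := by
  ext ⟨a, b⟩
  rw [mem_P₃_mm_pp_iff]
  simp only [jointGraph, Set.mem_ofPred_eq, Fin.exists_fin_one, Matrix.cons_val_fin_one, f₆,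
    mul_one]
  refine and_congr_right fun h => (eq_div_iff ?_).symm
  linarith

theorem sign_mul_sign_eq_neg_one {T : RealType} (h : T ∈ ({.pm, .mp} : Set RealType)) :
    (T.sign₁ : ℝ) * T.sign₂ = -1 := by
  rcases h with rfl | rfl <;> simp [RealType.sign₁, RealType.sign₂]

theorem sign_mul_sign_eq_one {T : RealType} (h : T ∈ ({.pp, .mm} : Set RealType)) :
    (T.sign₁ : ℝ) * T.sign₂ = 1 := by
  rcases h with rfl | rfl <;> simp [RealType.sign₁, RealType.sign₂]

/-- The invariants give `b² = a²`. The cubic invariant `-a(a² + 36)` is odd and vanishes only at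
`0`, so its sign excludes `b = -a` unless `a = 0`. -/
theorem eq_of_kequiv_indefinite {T₁ T₂ : RealType} (h₁ : T₁ ∈ ({.pm, .mp} : Set RealType))
    (h₂ : T₂ ∈ ({.pm, .mp} : Set RealType)) {a b : ℝ} (h : KEquiv (NF T₁ a) (NF T₂ b)) :
    b = a := by
  obtain ⟨s, -, hI, hJ⟩ := exists_real_invariants h
  have hJ' := cubic_invariant_sign h
  simp only [mul_assoc, sign_mul_sign_eq_neg_one h₁, sign_mul_sign_eq_neg_one h₂] at hI hJ
  rw [mul_assoc 36, mul_assoc 36, sign_mul_sign_eq_neg_one h₁, sign_mul_sign_eq_neg_one h₂] at hJ'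
  have key : b ^ 2 = a ^ 2 := by
    apply sq_eq_sq_of_modularRel
    have e : -108 * ((a ^ 2 - b ^ 2) * ((a ^ 2 * b ^ 2 - 4 * b ^ 2 + 4 * a ^ 2 - 144) ^ 2 +
        (4 * a * b ^ 2 - 48 * a) ^ 2)) =
        (12 * -1 + b ^ 2) ^ 3 * (a * (36 * -1 - a ^ 2)) ^ 2 -
          (12 * -1 + a ^ 2) ^ 3 * (b * (36 * -1 - b ^ 2)) ^ 2 := by ring
    rw [hI, hJ] at e
    have e0 : -108 * ((a ^ 2 - b ^ 2) * ((a ^ 2 * b ^ 2 - 4 * b ^ 2 + 4 * a ^ 2 - 144) ^ 2 +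
        (4 * a * b ^ 2 - 48 * a) ^ 2)) = 0 := by rw [e]; ring
    simpa using e0
  rcases sq_eq_sq_iff_eq_or_eq_neg.1 key with h | rfl
  · exact h
  · have hz := eq_zero_of_mul_nonneg_of_mul_pow (d := 1) (k := -1) hJ' (by ring) (by norm_num)
    rcases mul_eq_zero.1 hz with h | h
    · rw [h, neg_zero]
    · nlinarith [sq_nonneg a]

theorem P₃_indefinite {T₁ T₂ : RealType} (h₁ : T₁ ∈ ({.pm, .mp} : Set RealType))
    (h₂ : T₂ ∈ ({.pm, .mp} : Set RealType)) : P₃ T₁ T₂ = jointGraph Set.univ ![f₁ 1 1] := by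
  ext ⟨a, b⟩
  have hadm : ∀ {T : RealType}, T ∈ ({.pm, .mp} : Set RealType) → ∀ c : ℝ, Admissible T c := by
    rintro T (rfl | rfl) c <;> exact fun h => by nlinarith [sq_nonneg c]
  simp only [jointGraph, Set.mem_ofPred_eq, Set.mem_univ, true_and, Fin.exists_fin_one,
    Matrix.cons_val_fin_one, f₁, one_mul]
  constructor
  · rintro ⟨-, -, h⟩
    exact eq_of_kequiv_indefinite h₁ h₂ h
  · rintro rfl
    refine ⟨hadm h₁ _, hadm h₂ _, ?_⟩
    rcases h₁ with rfl | rfl <;> rcases h₂ with rfl | rfl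
    · exact .refl _
    · exact kequiv_of_swap _ rfl rfl
    · exact kequiv_of_swap _ rfl rfl
    · exact .refl _

/-- The discriminant `I³ - J²` is `108 (a² - 4)² ≥ 0` on one side and `-108 (b² + 4)² < 0` on the
other, and a real substitution multiplies it by `s⁶ ≥ 0`. -/
theorem not_kequiv_definite_indefinite {T₁ T₂ : RealType}
    (h₁ : T₁ ∈ ({.pp, .mm} : Set RealType)) (h₂ : T₂ ∈ ({.pm, .mp} : Set RealType)) {a b : ℝ} :
    ¬ KEquiv (NF T₁ a) (NF T₂ b) := by
  intro h
  obtain ⟨s, hs, hI, hJ⟩ := exists_real_invariants h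
  simp only [mul_assoc, sign_mul_sign_eq_one h₁, sign_mul_sign_eq_neg_one h₂] at hI hJ
  have e : -(108 * (b ^ 2 + 4) ^ 2) =
      (12 * -1 + b ^ 2) ^ 3 - (b * (36 * -1 - b ^ 2)) ^ 2 := by ring
  rw [hI, hJ] at e
  have e' : -(108 * (b ^ 2 + 4) ^ 2) = s ^ 6 * (108 * (a ^ 2 - 4) ^ 2) := by rw [e]; ring
  have h1 : 0 ≤ s ^ 6 * (108 * (a ^ 2 - 4) ^ 2) := by positivity
  have h2 : 0 < 108 * (b ^ 2 + 4) ^ 2 := by positivity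
  linarith

end Real

/-! ### Assembly of the cases. -/

theorem twist_eq_one {T : RealType} (h : T ∈ ({.pp, .mm} : Set RealType)) : twist T = 1 := by
  rcases h with rfl | rfl <;> rfl

theorem twist_eq_I {T : RealType} (h : T ∈ ({.pm, .mp} : Set RealType)) :
    twist T = Complex.I := by
  rcases h with rfl | rfl <;> rfl

theorem P₁_eq_of_twist_eq_one {T₁ T₂ : RealType} (h : twist T₁ = 1) :
    P₁ T₁ T₂ = jointGraph C' (family 1 (twist T₂)) := by
  rw [P₁_eq_jointGraph, h]
  simp only [mul_one]
  rfl

theorem P₁_eq_of_twist_eq_I {T₁ T₂ : RealType} (h : twist T₁ = Complex.I) :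
    P₁ T₁ T₂ = jointGraph C'' (family Complex.I (twist T₂)) := by
  rw [P₁_eq_jointGraph, h]
  rfl

theorem theorem6p1 :
    -- both subtypes in `{X₉⁺⁺, X₉⁻⁻}`
    (∀ T₁ ∈ ({.pp, .mm} : Set RealType), ∀ T₂ ∈ ({.pp, .mm} : Set RealType),
      P₁ T₁ T₂ = jointGraph C' (family 1 1) ∧
      P₂ T₁ T₂ = jointGraph R' (family 1 1)) ∧
    P₃ .pp .pp = jointGraph R' ![f₁ 1 1] ∪ jointGraph {a | a ∈ R' ∧ -2 < a} ![f₅ 1 1] ∧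
    P₃ .mm .mm = jointGraph R' ![f₁ 1 1] ∪ jointGraph {a | a ∈ R' ∧ a < 2} ![f₃ 1 1] ∧
    P₃ .pp .mm = jointGraph {a | a < -2} ![f₄ 1 1] ∧
    P₃ .mm .pp = jointGraph {a | 2 < a} ![f₆ 1 1] ∧
    -- both subtypes in `{X₉⁺⁻, X₉⁻⁺}`
    (∀ T₁ ∈ ({.pm, .mp} : Set RealType), ∀ T₂ ∈ ({.pm, .mp} : Set RealType),
      P₁ T₁ T₂ = jointGraph C'' (family Complex.I Complex.I) ∧
      P₂ T₁ T₂ = jointGraph Set.univ ![f₁ 1 1, f₂ 1 1] ∧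
      P₃ T₁ T₂ = jointGraph Set.univ ![f₁ 1 1]) ∧
    -- the mixed cases
    (∀ T₁ ∈ ({.pp, .mm} : Set RealType), ∀ T₂ ∈ ({.pm, .mp} : Set RealType),
      P₁ T₁ T₂ = jointGraph C' (family 1 Complex.I) ∧
      P₂ T₁ T₂ = {(-6, 0), (0, 0), (6, 0)} ∧
      P₃ T₁ T₂ = ∅) ∧
    (∀ T₁ ∈ ({.pm, .mp} : Set RealType), ∀ T₂ ∈ ({.pp, .mm} : Set RealType),
      P₁ T₁ T₂ = jointGraph C'' (family Complex.I 1) ∧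
      P₂ T₁ T₂ = {(0, -6), (0, 0), (0, 6)} ∧
      P₃ T₁ T₂ = ∅) := by
  refine ⟨fun T₁ h₁ T₂ h₂ => ⟨?_, P₂_eq_of_twist_eq_one (twist_eq_one h₁) (twist_eq_one h₂)⟩,
    P₃_pp_pp, P₃_mm_mm, P₃_pp_mm, P₃_mm_pp,
    fun T₁ h₁ T₂ h₂ => ⟨?_, P₂_eq_of_twist_eq_I (twist_eq_I h₁) (twist_eq_I h₂),
      P₃_indefinite h₁ h₂⟩,
    fun T₁ h₁ T₂ h₂ => ⟨?_, P₂_eq_of_twist_eq_one_of_twist_eq_I (twist_eq_one h₁) (twist_eq_I h₂),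
      ?_⟩,
    fun T₁ h₁ T₂ h₂ => ⟨?_, P₂_eq_of_twist_eq_I_of_twist_eq_one (twist_eq_I h₁) (twist_eq_one h₂),
      ?_⟩⟩
  · rw [P₁_eq_of_twist_eq_one (twist_eq_one h₁), twist_eq_one h₂]
  · rw [P₁_eq_of_twist_eq_I (twist_eq_I h₁), twist_eq_I h₂]
  · rw [P₁_eq_of_twist_eq_one (twist_eq_one h₁), twist_eq_I h₂]
  · exact Set.eq_empty_of_forall_notMem fun p hp => not_kequiv_definite_indefinite h₁ h₂ hp.2.2
  · rw [P₁_eq_of_twist_eq_I (twist_eq_I h₁), twist_eq_one h₂]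
  · exact Set.eq_empty_of_forall_notMem fun p hp =>
      not_kequiv_definite_indefinite h₂ h₁ hp.2.2.symm
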